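/- Let $q>2$ be a prime power and $n=q^2-1$, and let $a,b$ be integers with $0\le a\le q-1$ and $1\le b\le q$. An $[[n,k,d;c]]_q$ QUENTA code (entanglement-assisted quantum error-correcting code) encodes $k$ logical qudits of dimension $q$ into $n$ physical qudits using $c$ maximally entangled pairs of qudits shared in advance by sender and receiver. It is given by an isometry $V:(\mathbb{C}^q)^{\otimes k}\otimes(\mathbb{C}^q)^{\otimes c}\to(\mathbb{C}^q)^{\otimes n}$ applied by the sender to the logical qudits and to her halves of the pairs. The encoded states are $(V\otimes 1)(\psi\otimes\Phi^{\otimes c})$ with $\psi\in(\mathbb{C}^q)^{\otimes k}$ and $\Phi=q^{-1/2}\sum_{j}|j\rangle\otimes|j\rangle$. The code has distance (at least) $d$, meaning that with $P$ the orthogonal projector onto the space of encoded states, every operator $E$ acting on fewer than $d$ of the $n$ physical qudits satisfies $P(E\otimes 1)P=\mu P$ for some $\mu\in\mathbb{C}$, i.e. is detected (the receiver's halves are error-free). In particular the code corrects every error on at most $\lfloor (d-1)/2\rfloor$ physical qudits. Then there is a QUENTA code with parameters * $[[n,\,2(q-b)-1,\,b+1;\,2(q-a-1)]]_q$, if $a\ge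 q-b$ and $b<q$; * $[[n,\,2a+1,\,b+1;\,2b-\lfloor b/q\rfloor]]_q$, if $a<q-b$. -/

import Mathlib

open scoped Matrix Kronecker

/-- Labels of the computational basis of a register of `m` qudits of dimension `q`.  The state
space of the register, the `m`-fold tensor power of `ℂ^q`, consists of the vectors indexed by this
type, and operators between registers are matrices; the tensor product of two registers is indexed
by the product of the index types, and `⊗ₖ` is the tensor product of operators. -/
abbrev Register (q m : ℕ) : Type := Fin m → Fin q

/-- An entanglement-assisted quantum code that encodes `k` logical qudits of dimension `q` into
`n` physical qudits, with the help of `c` maximally entangled pairs of qudits shared beforehand by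
the sender and the receiver.  The sender applies an isometry to the `k` logical qudits and to her
halves of the `c` pairs (equivalently: a unitary on these qudits and `n - k - c` ancilla qudits in
a fixed state), the result being the `n` physical qudits sent through the channel. -/
structure EAQuantumCode (q n k c : ℕ) where
  encoder : Matrix (Register q n) (Register q k × Register q c) ℂ
  isometry : encoderᴴ * encoder = 1

/-- The amplitudes of `c` copies of the maximally entangled state `q^(-1/2) ∑ j, |j⟩ ⊗ |j⟩`;
the first register holds the sender's halves, the second one the receiver's halves. -/
noncomputable def maxEntangled (q c : ℕ) (y z : Register q c) : ℂ :=
  ∏ i, if y i = z i then ((Real.sqrt q : ℝ) : ℂ)⁻¹ else 0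

/-- The map that sends a logical state `ψ` to `ψ ⊗ Φ`, where `Φ` is the state of the `c`
maximally entangled pairs. -/
noncomputable def appendEntanglement (q k c : ℕ) :
    Matrix ((Register q k × Register q c) × Register q c) (Register q k) ℂ :=
  Matrix.of fun p u => if p.1.1 = u then maxEntangled q c p.1.2 p.2 else 0

/-- The operator `E` on `n` qudits acts nontrivially only on the qudits in `S`,
i.e. `E = g ⊗ 1` with `g` an operator on the qudits in `S`. -/
def Matrix.ActsOnlyOn {q n : ℕ} (E : Matrix (Register q n) (Register q n) ℂ)
    (S : Finset (Fin n)) : Prop :=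
  ∃ g : Matrix (S → Fin q) (S → Fin q) ℂ, ∀ x y : Register q n,
    ((∀ i, i ∉ S → x i = y i) → E x y = g (fun i => x i) (fun i => y i)) ∧
    ((∃ i, i ∉ S ∧ x i ≠ y i) → E x y = 0)

namespace EAQuantumCode

variable {q n k c : ℕ}

/-- The complete encoding map `ψ ↦ (V ⊗ 1)(ψ ⊗ Φ)`, where `V` is the sender's isometry and the
identity acts on the receiver's halves of the entangled pairs. -/
noncomputable def encode (Q : EAQuantumCode q n k c) :
    Matrix (Register q n × Register q c) (Register q k) ℂ :=
  (Q.encoder ⊗ₖ (1 : Matrix (Register q c) (Register q c) ℂ)) * appendEntanglement q k c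

/-- The orthogonal projector onto the space of encoded states. -/
noncomputable def proj (Q : EAQuantumCode q n k c) :
    Matrix (Register q n × Register q c) (Register q n × Register q c) ℂ :=
  Q.encode * Q.encodeᴴ

/-- The code detects the error `E` on the `n` physical qudits: `P (E ⊗ 1) P = μ P` for some scalar
`μ`, with `P` the projector onto the encoded states.  The receiver's `c` halves are free of
errors. -/
def Detects (Q : EAQuantumCode q n k c) (E : Matrix (Register q n) (Register q n) ℂ) : Prop :=
  ∃ μ : ℂ, Q.proj * (E ⊗ₖ (1 : Matrix (Register q c) (Register q c) ℂ)) * Q.proj = μ • Q.proj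

/-- The code has distance (at least) `d`: it detects every error that acts on fewer than `d` of
the physical qudits (and hence corrects every error on at most `⌊(d - 1) / 2⌋` of them). -/
def HasDistance (Q : EAQuantumCode q n k c) (d : ℕ) : Prop :=
  ∀ (S : Finset (Fin n)) (E : Matrix (Register q n) (Register q n) ℂ),
    S.card < d → E.ActsOnlyOn S → Q.Detects E

end EAQuantumCode

/-- There is a QUENTA (entanglement-assisted quantum error-correcting) code with parameters
`[[n, k, d; c]]_q`. -/
def ExistsQUENTA (q n k d c : ℕ) : Prop :=
  ∃ Q : EAQuantumCode q n k c, Q.HasDistance d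

/-! ### Matrix entries of errors between encoded states. -/

namespace EAQuantumCode

open Finset

/-! A CSS-type construction. Take subspaces `A`, `Y`, `L` of `F^n` in direct sum, with |F| = q, and
encode |u⟩|y⟩ as the uniform superposition over a coset of `A` whose representative has its `L`-part
given by u and its `Y`-part by y. The receiver's halves record y without error, so only `A ⊔ L`
needs minimum distance d against basis shifts. Against phase errors it suffices that `A ⊔ Y`
restricts onto any d - 1 coordinates. This is `existsQUENTA_of_submodules`.

Both properties come from nested codes `W ≤ N`, indexed by the points of Kˣ with [K : F] = 2
(`exists_nested_codes`). `N` has the BCH parity checks x, …, x^b and so distance at least b + 1. `W`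
contains the evaluations of traces of polynomials of degree less than b, which interpolate any b
values. The inclusion holds because power sums over Kˣ vanish for exponents strictly between 0 and
q² - 1.

In the first family `W` is split as `A ⊕ Y`. In the second, `A` is zero and `Y` is `W` plus one
vector outside `N`. In both, `L` lies in `N` and meets `W` trivially. -/

lemma appendEntanglement_apply (q k c : ℕ) (p : (Register q k × Register q c) × Register q c)
    (u : Register q k) :
    appendEntanglement q k c p u =
      if p.1.1 = u ∧ p.1.2 = p.2 then (((Real.sqrt q : ℝ) : ℂ)⁻¹) ^ c else 0 := by
  by_cases hu : p.1.1 = u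
  · by_cases hy : p.1.2 = p.2
    · simp [appendEntanglement, maxEntangled, hu, hy]
    · obtain ⟨i, hi⟩ := Function.ne_iff.mp hy
      simp only [appendEntanglement, Matrix.of_apply, maxEntangled, hu, hy, and_false, if_false,
        if_true]
      exact prod_eq_zero (mem_univ i) (if_neg hi)
  · simp [appendEntanglement, hu]

lemma encode_apply {q n k c : ℕ} (Q : EAQuantumCode q n k c) (x : Register q n)
    (z : Register q c) (u : Register q k) :
    Q.encode (x, z) u = Q.encoder x (u, z) * (((Real.sqrt q : ℝ) : ℂ)⁻¹) ^ c := by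
  rw [encode, Matrix.mul_apply, sum_eq_single ((u, z), z)]
  · simp [appendEntanglement_apply]
  · rintro ⟨⟨u', y⟩, z'⟩ - h
    rw [appendEntanglement_apply, Matrix.kroneckerMap_apply]
    by_cases hz : z = z'
    · subst hz
      rw [if_neg, mul_zero]
      rintro ⟨hu, hy⟩
      exact h (Prod.ext (Prod.ext hu hy) rfl)
    · simp [Matrix.one_apply_ne hz]
  · simp

lemma detects_of_conjTranspose_mul_mul {q n k c : ℕ} (Q : EAQuantumCode q n k c)
    (E : Matrix (Register q n) (Register q n) ℂ) (μ : ℂ)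
    (h : Q.encodeᴴ * (E ⊗ₖ (1 : Matrix (Register q c) (Register q c) ℂ)) * Q.encode = μ • 1) :
    Q.Detects E := by
  refine ⟨μ, ?_⟩
  calc Q.encode * Q.encodeᴴ * (E ⊗ₖ 1) * (Q.encode * Q.encodeᴴ)
      = Q.encode * (Q.encodeᴴ * (E ⊗ₖ (1 : Matrix (Register q c) (Register q c) ℂ)) * Q.encode)
          * Q.encodeᴴ := by simp only [Matrix.mul_assoc]
    _ = μ • Q.proj := by rw [h]; simp [proj]

lemma conjTranspose_mul_mul_apply {q n k c : ℕ} (Q : EAQuantumCode q n k c)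
    (E : Matrix (Register q n) (Register q n) ℂ) (u u' : Register q k) :
    (Q.encodeᴴ * (E ⊗ₖ (1 : Matrix (Register q c) (Register q c) ℂ)) * Q.encode) u u' =
      ∑ x', ∑ z, ∑ x, star (Q.encode (x, z) u) * E x x' * Q.encode (x', z) u' := by
  simp only [Matrix.mul_apply, Fintype.sum_prod_type, Matrix.conjTranspose_apply,
    Matrix.kroneckerMap_apply, sum_mul]
  refine sum_congr rfl fun x' _ => sum_congr rfl fun z _ => sum_congr rfl fun x _ => ?_
  rw [sum_eq_single z]
  · simp
  · intro z' _ hz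
    simp [Matrix.one_apply_ne hz]
  · simp

end EAQuantumCode

lemma Matrix.ActsOnlyOn.apply_eq {q n : ℕ} {E : Matrix (Register q n) (Register q n) ℂ}
    {S : Finset (Fin n)} (h : E.ActsOnlyOn S) {x x' w w' : Register q n}
    (hx : ∀ i ∈ S, x i = w i) (hx' : ∀ i ∈ S, x' i = w' i)
    (hxx' : ∀ i, i ∉ S → (x i = x' i ↔ w i = w' i)) : E x x' = E w w' := by
  obtain ⟨g, hg⟩ := h
  by_cases hS : ∀ i, i ∉ S → x i = x' i
  · rw [(hg x x').1 hS, (hg w w').1 fun i hi => (hxx' i hi).1 (hS i hi)]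
    congr 1 <;> funext i
    · exact hx i i.2
    · exact hx' i i.2
  · push Not at hS
    obtain ⟨i, hi, hne⟩ := hS
    rw [(hg x x').2 ⟨i, hi, hne⟩, (hg w w').2 ⟨i, hi, fun h => hne ((hxx' i hi).2 h)⟩]

/-! ### Entanglement-assisted codes from linear subspaces. -/

section LinearCodes

variable {F : Type*} [Field F] [Fintype F] {q n k c d : ℕ}

open Classical in
/-- The encoder with `|u⟩|y⟩ ↦ |A|^(-1/2) ∑ s ∈ A, |g (u, y) + s⟩`, the labels of the
computational basis being identified with the elements of `F`. -/
noncomputable def cosetEncoder (e : Fin q ≃ F) (A : Submodule F (Fin n → F))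
    (g : ((Fin k → F) × (Fin c → F)) →ₗ[F] (Fin n → F)) :
    Matrix (Register q n) (Register q k × Register q c) ℂ :=
  Matrix.of fun x p =>
    if e ∘ x - g (e ∘ p.1, e ∘ p.2) ∈ A then ((Real.sqrt (Nat.card A) : ℝ) : ℂ)⁻¹ else 0

lemma cosetEncoder_isometry (e : Fin q ≃ F) (A : Submodule F (Fin n → F))
    (g : ((Fin k → F) × (Fin c → F)) →ₗ[F] (Fin n → F))
    (hg : ∀ p, g p ∈ A → p = 0) :
    (cosetEncoder e A g)ᴴ * cosetEncoder e A g = 1 := by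
  classical
  ext p p'
  rw [Matrix.mul_apply]
  by_cases hp : p = p'
  · subst hp
    rw [Matrix.one_apply_eq]
    have hcard : (Finset.univ.filter fun x : Register q n =>
        e ∘ x - g (e ∘ p.1, e ∘ p.2) ∈ A).card = Nat.card A := by
      rw [← Fintype.card_subtype, ← Nat.card_eq_fintype_card]
      refine Nat.card_congr (Equiv.subtypeEquiv ((Equiv.arrowCongr (Equiv.refl _) e).trans
        (Equiv.subRight (g (e ∘ p.1, e ∘ p.2)))) fun x => ?_)
      rfl
    have hpos : (0 : ℝ) < Nat.card A := by exact_mod_cast Nat.card_pos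
    have hsq : ((Real.sqrt (Nat.card A) : ℝ) : ℂ)⁻¹ * ((Real.sqrt (Nat.card A) : ℝ) : ℂ)⁻¹ =
        ((Nat.card A : ℕ) : ℂ)⁻¹ := by
      rw [← mul_inv, ← Complex.ofReal_mul, Real.mul_self_sqrt hpos.le, Complex.ofReal_natCast]
    have hterm : ∀ x : Register q n,
        (cosetEncoder e A g)ᴴ p x * cosetEncoder e A g x p =
        if e ∘ x - g (e ∘ p.1, e ∘ p.2) ∈ A then ((Nat.card A : ℕ) : ℂ)⁻¹ else 0 := by
      intro x
      rw [Matrix.conjTranspose_apply, cosetEncoder, Matrix.of_apply]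
      split_ifs
      · rw [← hsq]; simp
      · simp
    rw [Finset.sum_congr rfl fun x _ => hterm x, ← Finset.sum_filter, Finset.sum_const, hcard,
      nsmul_eq_mul, mul_inv_cancel₀]
    exact_mod_cast hpos.ne'
  · rw [Matrix.one_apply_ne hp]
    refine Finset.sum_eq_zero fun x _ => ?_
    rw [Matrix.conjTranspose_apply, cosetEncoder, Matrix.of_apply, Matrix.of_apply]
    by_cases h1 : e ∘ x - g (e ∘ p.1, e ∘ p.2) ∈ A
    · rw [if_neg (c := _ - g (e ∘ p'.1, _) ∈ A), mul_zero]
      intro h2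
      have h3 := hg ((e ∘ p.1, e ∘ p.2) - (e ∘ p'.1, e ∘ p'.2)) (by
        rw [map_sub]; convert A.sub_mem h2 h1 using 1; abel)
      rw [sub_eq_zero, Prod.mk.injEq] at h3
      exact hp (Prod.ext (e.injective.comp_left h3.1) (e.injective.comp_left h3.2))
    · rw [if_neg h1, star_zero, zero_mul]

/-- The Knill–Laflamme conditions: `hX` makes the off-diagonal entries of the compressed error
vanish, and `hZ` makes the diagonal ones equal. -/
lemma existsQUENTA_of_linearMap (hF : Fintype.card F = q) (A : Submodule F (Fin n → F))
    (g : ((Fin k → F) × (Fin c → F)) →ₗ[F] (Fin n → F))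
    (hg : ∀ p, g p ∈ A → p = 0)
    (hX : ∀ u, ∀ s ∈ A, ∀ S : Finset (Fin n), S.card < d →
      (∀ i, i ∉ S → (g (u, 0) + s) i = 0) → u = 0)
    (hZ : ∀ u, ∀ S : Finset (Fin n), S.card < d →
      ∃ y, ∃ s ∈ A, ∀ i ∈ S, (g (0, y) + s) i = g (u, 0) i) :
    ExistsQUENTA q n k d c := by
  classical
  let e : Fin q ≃ F := (Fintype.equivFinOfCardEq hF).symm
  let Q : EAQuantumCode q n k c := ⟨cosetEncoder e A g, cosetEncoder_isometry e A g hg⟩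
  refine ⟨Q, fun S E hS hE => ?_⟩
  let M := Q.encodeᴴ * (E ⊗ₖ (1 : Matrix (Register q c) (Register q c) ℂ)) * Q.encode
  let u₀ : Register q k := e.symm ∘ 0
  have hu₀ : e ∘ u₀ = 0 := by funext i; simp [u₀]
  refine Q.detects_of_conjTranspose_mul_mul E (M u₀ u₀) ?_
  have hM : ∀ u u', M u u' = _ := Q.conjTranspose_mul_mul_apply E
  change M = _
  ext u u'
  by_cases hu : u = u'
  · subst hu
    rw [Matrix.smul_apply, Matrix.one_apply_eq, smul_eq_mul, mul_one, hM, hM]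
    obtain ⟨y, s, hs, hys⟩ := hZ (e ∘ u) S hS
    -- Translating the physical register by `-v` and the receiver's label by `y` turns the encoding
    -- of `u` into that of the zero state. The entries of `E` are unchanged, since `v` vanishes on
    -- `S` and differences off `S` are preserved.
    set v := g (e ∘ u, 0) - (g (0, y) + s) with hv
    have hvS : ∀ i ∈ S, v i = 0 := fun i hi => by
      rw [hv, Pi.sub_apply, hys i hi, sub_self]
    let σ : Register q n ≃ Register q n :=
      ((Equiv.arrowCongr (Equiv.refl _) e).trans (Equiv.subRight v)).trans
        (Equiv.arrowCongr (Equiv.refl _) e.symm)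
    let τ : Register q c ≃ Register q c :=
      ((Equiv.arrowCongr (Equiv.refl _) e).trans (Equiv.addRight y)).trans
        (Equiv.arrowCongr (Equiv.refl _) e.symm)
    have hσ : ∀ x, e ∘ σ x = e ∘ x - v := fun x => by funext i; simp [σ]
    have hτ : ∀ z, e ∘ τ z = e ∘ z + y := fun z => by funext i; simp [τ]
    have hσi : ∀ x i, e (σ x i) = e (x i) - v i := fun x i => congrFun (hσ x) i
    have henc : ∀ x z, Q.encode (x, z) u = Q.encode (σ x, τ z) u₀ := by
      intro x z
      rw [Q.encode_apply, Q.encode_apply]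
      congr 1
      simp only [Q, cosetEncoder, Matrix.of_apply, hσ, hτ, hu₀]
      refine if_congr ?_ rfl rfl
      have h1 : g (e ∘ u, e ∘ z) = g (e ∘ u, 0) + g (0, e ∘ z) := by rw [← map_add]; simp
      have h2 : g (0, e ∘ z + y) = g (0, e ∘ z) + g (0, y) := by rw [← map_add]; simp
      rw [h1, h2, ← A.add_mem_iff_left hs, hv]
      refine iff_of_eq (congrArg (· ∈ A) ?_)
      abel
    refine Fintype.sum_equiv σ _ _ fun x' => Fintype.sum_equiv τ _ _ fun z =>
      Fintype.sum_equiv σ _ _ fun x => ?_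
    rw [henc, henc, hE.apply_eq (w := σ x) (w' := σ x')]
    · intro i hi
      apply e.injective
      rw [hσi, hvS i hi, sub_zero]
    · intro i hi
      apply e.injective
      rw [hσi, hvS i hi, sub_zero]
    · intro i _
      rw [← e.injective.eq_iff (a := σ x i), hσi, hσi, sub_left_inj, e.injective.eq_iff]
  · rw [Matrix.smul_apply, Matrix.one_apply_ne hu, smul_zero, hM]
    refine Finset.sum_eq_zero fun x' _ => Finset.sum_eq_zero fun z _ =>
      Finset.sum_eq_zero fun x _ => ?_
    rw [Q.encode_apply, Q.encode_apply]
    simp only [Q, cosetEncoder, Matrix.of_apply]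
    -- Both encoded states carry the same receiver label `z`, so the `z`-parts cancel in `x - x'`,
    -- which is therefore an element of `g (u - u', 0) + A` supported on `S`.
    by_cases h1 : e ∘ x - g (e ∘ u, e ∘ z) ∈ A
    · by_cases h2 : e ∘ x' - g (e ∘ u', e ∘ z) ∈ A
      · by_cases h3 : ∃ i, i ∉ S ∧ x i ≠ x' i
        · obtain ⟨f, hf⟩ := hE
          rw [(hf x x').2 h3, mul_zero, zero_mul]
        · push Not at h3
          have h4 := hX (e ∘ u - e ∘ u') _ (A.sub_mem h1 h2) S hS (fun i hi => by
            have h5 : g (e ∘ u - e ∘ u', 0) = g (e ∘ u, e ∘ z) - g (e ∘ u', e ∘ z) := by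
              rw [← map_sub]; simp
            rw [h5]
            simp [h3 i hi])
          exact absurd (e.injective.comp_left (sub_eq_zero.mp h4)) hu
      · rw [if_neg h2, zero_mul, mul_zero]
    · rw [if_neg h1, zero_mul, star_zero, zero_mul, zero_mul]

lemma existsQUENTA_of_submodules (hF : Fintype.card F = q) (A Y L : Submodule F (Fin n → F))
    (hL : Module.finrank F L = k) (hY : Module.finrank F Y = c)
    (hAY : Disjoint A Y) (hAYL : Disjoint (A ⊔ Y) L)
    (hX : ∀ v ∈ A ⊔ L, ∀ S : Finset (Fin n), S.card < d → (∀ i, i ∉ S → v i = 0) → v = 0)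
    (hZ : ∀ (v : Fin n → F) (S : Finset (Fin n)), S.card < d →
      ∃ w ∈ A ⊔ Y, ∀ i ∈ S, w i = v i) :
    ExistsQUENTA q n k d c := by
  let eL : (Fin k → F) ≃ₗ[F] L := LinearEquiv.ofFinrankEq _ _ (by simp [hL])
  let eY : (Fin c → F) ≃ₗ[F] Y := LinearEquiv.ofFinrankEq _ _ (by simp [hY])
  let g : ((Fin k → F) × (Fin c → F)) →ₗ[F] (Fin n → F) :=
    (L.subtype ∘ₗ eL.toLinearMap).coprod (Y.subtype ∘ₗ eY.toLinearMap)
  have hg : ∀ u y, g (u, y) = (eL u : Fin n → F) + eY y := fun u y => rfl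
  have hzero : ∀ u y, ∀ s ∈ A, s + eY y + (eL u : Fin n → F) = 0 → u = 0 ∧ y = 0 := by
    intro u y s hs h
    have h1 : (eL u : Fin n → F) = 0 := by
      refine Submodule.disjoint_def.mp hAYL _ ?_ (eL u).2
      rw [← neg_eq_of_add_eq_zero_right h]
      exact neg_mem (Submodule.add_mem_sup hs (eY y).2)
    have h2 : (eY y : Fin n → F) = 0 := by
      refine Submodule.disjoint_def.mp hAY _ ?_ (eY y).2
      rw [h1, add_zero] at h
      rw [← neg_eq_of_add_eq_zero_right h]
      exact neg_mem hs
    exact ⟨by simpa using h1, by simpa using h2⟩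
  refine existsQUENTA_of_linearMap hF A g ?_ ?_ ?_
  · rintro ⟨u, y⟩ h
    obtain ⟨rfl, rfl⟩ := hzero u y _ (neg_mem h) (by rw [hg]; abel)
    rfl
  · intro u s hs S hS h
    have h1 := hX (g (u, 0) + s) (by
      rw [hg, map_zero, ZeroMemClass.coe_zero, add_zero, add_comm]
      exact Submodule.add_mem_sup hs (eL u).2) S hS h
    refine (hzero u 0 s hs ?_).1
    rw [← h1, hg]; abel
  · intro u S hS
    obtain ⟨w, hw, hwS⟩ := hZ (g (u, 0)) S hS
    obtain ⟨s, hs, y, hy, rfl⟩ := Submodule.mem_sup.mp hw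
    refine ⟨eY.symm ⟨y, hy⟩, s, hs, fun i hi => ?_⟩
    rw [← hwS i hi, hg]
    simp [add_comm]

end LinearCodes

/-! ### Subspaces of prescribed dimension, and Lagrange interpolation. -/

lemma Submodule.exists_between_finrank_eq {F V : Type*} [Field F] [AddCommGroup V] [Module F V]
    [Module.Finite F V] {U W : Submodule F V} (hUW : U ≤ W) {m : ℕ}
    (hU : Module.finrank F U ≤ m) (hW : m ≤ Module.finrank F W) :
    ∃ X : Submodule F V, U ≤ X ∧ X ≤ W ∧ Module.finrank F X = m := by
  induction m, hU using Nat.le_induction with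
  | base => exact ⟨U, le_rfl, hUW, rfl⟩
  | succ m _ ih =>
    obtain ⟨X, hUX, hXW, hX⟩ := ih (by omega)
    obtain ⟨v, hvW, hvX⟩ := SetLike.exists_of_lt (lt_of_le_of_ne hXW (by rintro rfl; omega))
    refine ⟨X ⊔ Submodule.span F {v}, hUX.trans le_sup_left, sup_le hXW ?_, ?_⟩
    · rwa [Submodule.span_singleton_le_iff_mem]
    · rw [Submodule.finrank_sup_span_singleton hvX, hX]

lemma Submodule.exists_disjoint_finrank_eq {F V : Type*} [Field F] [AddCommGroup V] [Module F V]
    [Module.Finite F V] {U W : Submodule F V} (hUW : U ≤ W) {m : ℕ}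
    (hm : Module.finrank F U + m ≤ Module.finrank F W) :
    ∃ X ≤ W, Disjoint U X ∧ Module.finrank F X = m := by
  obtain ⟨C, hC⟩ := Submodule.exists_isCompl U
  have hsup : U ⊔ C ⊓ W = W := by
    rw [← sup_inf_assoc_of_le C hUW, hC.sup_eq_top, top_inf_eq]
  have hdisj : Disjoint U (C ⊓ W) := hC.disjoint.mono_right inf_le_left
  have hdim := Submodule.finrank_sup_add_finrank_inf_eq U (C ⊓ W)
  rw [hsup, hdisj.eq_bot, finrank_bot] at hdim
  obtain ⟨X, -, hX, hXm⟩ := Submodule.exists_between_finrank_eq (bot_le : ⊥ ≤ C ⊓ W) (m := m)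
    (by rw [finrank_bot]; exact Nat.zero_le m) (by omega)
  exact ⟨X, hX.trans inf_le_right, hdisj.mono_right hX, hXm⟩

lemma exists_sum_mul_pow_eq {K ι : Type*} [Field K] {x : ι → K} (hx : Function.Injective x)
    {b : ℕ} (S : Finset ι) (hS : S.card ≤ b) (t : ι → K) :
    ∃ c : Fin b → K, ∀ i ∈ S, ∑ j, c j * x i ^ (j : ℕ) = t i := by
  classical
  refine ⟨fun j => (Lagrange.interpolate S x t).coeff j, fun i hi => ?_⟩
  have hdeg := (Lagrange.degree_interpolate_lt t hx.injOn (s := S)).trans_le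
    (WithBot.coe_le_coe.mpr (Nat.cast_le.mpr hS))
  rw [← Lagrange.eval_interpolate_at_node t hx.injOn hi,
    Fin.sum_univ_eq_sum_range (fun j => (Lagrange.interpolate S x t).coeff j * x i ^ j) b,
    Polynomial.eval_eq_sum,
    Polynomial.sum_over_range' _ (fun _ => by simp) b ?_]
  -- The zero polynomial has `natDegree` 0, which is not below `b` when `b = 0`; but then `S` is
  -- empty, against `hi`.
  by_cases h0 : Lagrange.interpolate S x t = 0
  · rw [h0, Polynomial.natDegree_zero]
    by_contra hb
    obtain rfl : b = 0 := by omega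
    simp_all
  · exact (Polynomial.natDegree_lt_iff_degree_lt h0).mpr hdeg

/-! ### BCH codes and trace codes on the nonzero points of a quadratic extension. -/

section Codes

variable {F K : Type*} [Field F] [Field K] [Algebra F K] {n : ℕ}

/-- The `K`-valued syndrome with respect to the parity checks `x ^ 1, …, x ^ b`. -/
def bchSyndrome (F : Type*) [Field F] [Algebra F K] (x : Fin n → K) (b : ℕ) :
    (Fin n → F) →ₗ[F] (Fin b → K) where
  toFun f := fun j => ∑ i, f i • x i ^ ((j : ℕ) + 1)
  map_add' f f' := by
    funext j
    simp [add_smul, Finset.sum_add_distrib]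
  map_smul' r f := by
    funext j
    simp [mul_smul, Finset.smul_sum]

/-- The evaluation at the points `x` of the functions
`c + Tr (β 0 * X ^ 1) + ⋯ + Tr (β (m - 1) * X ^ m)`. -/
noncomputable def traceEval (F : Type*) [Field F] [Algebra F K] (x : Fin n → K) (m : ℕ) :
    (F × (Fin m → K)) →ₗ[F] (Fin n → F) where
  toFun p := fun i => p.1 + ∑ l, Algebra.trace F K (p.2 l * x i ^ ((l : ℕ) + 1))
  map_add' p p' := by
    funext i
    simp only [Prod.fst_add, Prod.snd_add, Pi.add_apply, add_mul, map_add, Finset.sum_add_distrib]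
    ring
  map_smul' r p := by
    funext i
    simp [Finset.mul_sum, mul_add]

/-- The BCH bound, by pairing the syndrome with a polynomial that isolates one coordinate of the
support. -/
lemma eq_zero_of_bchSyndrome_eq_zero {x : Fin n → K} (hx : Function.Injective x)
    (hx0 : ∀ i, x i ≠ 0) {b : ℕ} {f : Fin n → F} (hf : bchSyndrome F x b f = 0)
    (S : Finset (Fin n)) (hS : S.card ≤ b) (hfS : ∀ i, i ∉ S → f i = 0) : f = 0 := by
  classical
  funext i₀
  by_cases hi₀ : i₀ ∈ S
  swap
  · exact hfS i₀ hi₀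
  -- The inverse compensates for the checks starting at `x ^ 1` instead of `x ^ 0`.
  obtain ⟨c, hc⟩ := exists_sum_mul_pow_eq hx S hS (Pi.single i₀ (x i₀)⁻¹)
  have h1 : ∑ j, c j * bchSyndrome F x b f j = f i₀ • (1 : K) := by
    calc ∑ j, c j * bchSyndrome F x b f j
        = ∑ i, (f i • x i) * ∑ j, c j * x i ^ (j : ℕ) := by
          simp only [bchSyndrome, LinearMap.coe_mk, AddHom.coe_mk, Finset.mul_sum]
          rw [Finset.sum_comm]
          refine Finset.sum_congr rfl fun i _ => Finset.sum_congr rfl fun j _ => ?_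
          rw [pow_succ]
          simp only [Algebra.smul_def]
          ring
      _ = (f i₀ • x i₀) * ∑ j, c j * x i₀ ^ (j : ℕ) := by
          refine Finset.sum_eq_single i₀ (fun i _ hi => ?_) (by simp)
          by_cases hiS : i ∈ S
          · rw [hc i hiS, Pi.single_eq_of_ne hi, mul_zero]
          · rw [hfS i hiS, zero_smul, zero_mul]
      _ = f i₀ • (1 : K) := by
          rw [hc i₀ hi₀, Pi.single_eq_same, smul_mul_assoc, mul_inv_cancel₀ (hx0 i₀)]
  rw [hf] at h1
  simpa using h1.symm

/-- Interpolate over `K` the values `v i • τ`, where `τ` has trace 1, and take traces. Only the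
trace of the constant coefficient matters, so the constants cost one dimension over `F`, not two. -/
lemma exists_traceEval_eq [Finite K] {x : Fin n → K} (hx : Function.Injective x) {m : ℕ}
    (S : Finset (Fin n)) (hS : S.card ≤ m + 1) (v : Fin n → F) :
    ∃ p, ∀ i ∈ S, traceEval F x m p i = v i := by
  have : Finite F := Finite.of_injective _ (algebraMap F K).injective
  obtain ⟨τ, hτ⟩ := Algebra.trace_surjective F K 1
  obtain ⟨c, hc⟩ := exists_sum_mul_pow_eq hx S hS (fun i => v i • τ)
  refine ⟨(Algebra.trace F K (c 0), fun l => c l.succ), fun i hi => ?_⟩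
  have h := congrArg (Algebra.trace F K) (hc i hi)
  rw [map_smul, hτ, smul_eq_mul, mul_one, Fin.sum_univ_succ, map_add, map_sum] at h
  simpa [traceEval] using h

/-- Since Tr z = z + z^q, every syndrome is a combination of power sums over Kˣ with exponents j, l
+ j and lq + j, where 1 ≤ l ≤ b and 1 ≤ j ≤ b + 1. As b + 1 < q, these are positive and at most (q -
2)q + (q - 1) < q² - 1, so the sums vanish. -/
lemma bchSyndrome_traceEval [Fintype F] [Fintype K] (hK : Module.finrank F K = 2)
    (x : Fin n ≃ Kˣ) {b : ℕ} (hb : b + 1 < Fintype.card F) (p : F × (Fin b → K)) :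
    bchSyndrome F (fun i => (x i : K)) (b + 1) (traceEval F (fun i => (x i : K)) b p) = 0 := by
  classical
  set q := Fintype.card F with hq
  have hcard : Fintype.card K = q ^ 2 := by rw [Module.card_eq_pow_finrank (K := F), hK]
  have hsum : ∀ m, 0 < m → m < q ^ 2 - 1 → ∑ i, (x i : K) ^ m = 0 := by
    intro m h0 hm
    rw [Equiv.sum_comp x (fun y : Kˣ => (y : K) ^ m), FiniteField.sum_pow_units, hcard, if_neg]
    exact fun h => absurd (Nat.le_of_dvd h0 h) (by omega)
  funext j
  have hj := j.2
  have hterm : ∀ i, traceEval F (fun i => (x i : K)) b p i • (x i : K) ^ ((j : ℕ) + 1) =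
      algebraMap F K p.1 * (x i : K) ^ ((j : ℕ) + 1) +
      ∑ l, (p.2 l * (x i : K) ^ ((l : ℕ) + 1 + (j + 1)) +
        p.2 l ^ q * (x i : K) ^ (((l : ℕ) + 1) * q + (j + 1))) := by
    intro i
    simp only [traceEval, LinearMap.coe_mk, AddHom.coe_mk]
    rw [Algebra.smul_def, map_add, map_sum, add_mul, Finset.sum_mul]
    congr 1
    refine Finset.sum_congr rfl fun l _ => ?_
    rw [FiniteField.algebraMap_trace_eq_sum_pow, hK, Finset.sum_range_succ, Finset.sum_range_one,
      Nat.card_eq_fintype_card, ← hq, pow_zero, pow_one, pow_one, mul_pow, ← pow_mul]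
    ring
  have h2q : q * 2 ≤ q ^ 2 := by rw [sq]; exact Nat.mul_le_mul_left q (by omega)
  simp only [bchSyndrome, LinearMap.coe_mk, AddHom.coe_mk, Pi.zero_apply]
  rw [Finset.sum_congr rfl fun i _ => hterm i, Finset.sum_add_distrib, ← Finset.mul_sum,
    hsum _ (by omega) (by omega), mul_zero, zero_add, Finset.sum_comm]
  refine Finset.sum_eq_zero fun l _ => ?_
  have hl := l.2
  have h1 : (l : ℕ) + 2 ≤ q - 1 := by omega
  obtain ⟨r, hr⟩ : ∃ r, q = (l : ℕ) + 3 + r := ⟨q - (l + 3), by omega⟩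
  have hq2 : (l + 1) * q + q + (q + q * r) = q ^ 2 := by
    rw [hr]; ring
  rw [Finset.sum_add_distrib, ← Finset.mul_sum, ← Finset.mul_sum, hsum _ (by omega),
    hsum _ (by omega), mul_zero, mul_zero, add_zero]
  · have : q ≤ q + q * r := Nat.le_add_right _ _
    omega
  · have : q ≤ q + q * r := Nat.le_add_right _ _
    have : q ≤ (l + 1) * q := Nat.le_mul_of_pos_left _ (by omega)
    omega

end Codes

/-! ### The nested codes and the choice of parameters. -/

theorem FiniteField.exists_finrank_eq_two {q : ℕ} (hq : IsPrimePow q) :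
    ∃ (F K : Type) (_ : Field F) (_ : Fintype F) (_ : Field K) (_ : Fintype K) (_ : Algebra F K),
      Fintype.card F = q ∧ Module.finrank F K = 2 := by
  obtain ⟨p, r, hp, hr, rfl⟩ := hq
  have : Fact p.Prime := ⟨hp.nat_prime⟩
  have hcard := GaloisField.card p r hr.ne'
  have := Fintype.ofFinite (GaloisField p r)
  exact ⟨GaloisField p r, FiniteField.Extension (GaloisField p r) p 2, inferInstance,
    inferInstance, inferInstance, Fintype.ofFinite _, inferInstance,
    by rw [← Nat.card_eq_fintype_card, hcard], FiniteField.finrank_extension _ p 2⟩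

/-- There are nested codes `W ≤ N` of length `q ^ 2 - 1` over a field with `q` elements such that `N` has minimum distance at least `b + 2` and the restriction of `W` to any `b + 1` coordinates is onto. -/
lemma exists_nested_codes {F K : Type*} [Field F] [Fintype F] [Field K] [Fintype K] [Algebra F K]
    (hK : Module.finrank F K = 2) {n b : ℕ} (hn : n = Fintype.card F ^ 2 - 1)
    (hb : b + 1 < Fintype.card F) :
    ∃ W N : Submodule F (Fin n → F), W ≤ N ∧ N ≠ ⊤ ∧ Module.finrank F W = 2 * b + 1 ∧
      n ≤ Module.finrank F N + 2 * (b + 1) ∧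
      (∀ v ∈ N, ∀ S : Finset (Fin n), S.card < b + 2 → (∀ i, i ∉ S → v i = 0) → v = 0) ∧
      (∀ (v : Fin n → F) (S : Finset (Fin n)), S.card < b + 2 →
        ∃ w ∈ W, ∀ i ∈ S, w i = v i) := by
  classical
  have hcard : Fintype.card (Kˣ) = n := by
    rw [Fintype.card_units, Module.card_eq_pow_finrank (K := F), hK, hn]
  let x : Fin n ≃ Kˣ := (Fintype.equivFinOfCardEq hcard).symm
  have hx : Function.Injective fun i => (x i : K) := Units.val_injective.comp x.injective
  have hx0 : ∀ i, (x i : K) ≠ 0 := fun i => (x i).ne_zero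
  set N := LinearMap.ker (bchSyndrome F (fun i => (x i : K)) (b + 1)) with hNdef
  set W₀ := LinearMap.range (traceEval F (fun i => (x i : K)) b) with hWdef
  have hWN : W₀ ≤ N := by
    rintro _ ⟨p, rfl⟩
    exact bchSyndrome_traceEval hK x hb p
  have hdist : ∀ v ∈ N, ∀ S : Finset (Fin n), S.card < b + 2 →
      (∀ i, i ∉ S → v i = 0) → v = 0 := fun v hv S hS h =>
    eq_zero_of_bchSyndrome_eq_zero hx hx0 hv S (by omega) h
  have hN : n ≤ Module.finrank F N + 2 * (b + 1) := by
    have h1 := LinearMap.finrank_range_add_finrank_ker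
      (bchSyndrome F (fun i => (x i : K)) (b + 1))
    have h2 := Submodule.finrank_le
      (LinearMap.range (bchSyndrome F (fun i => (x i : K)) (b + 1)))
    rw [Module.finrank_pi_fintype, Finset.sum_const, hK] at h2
    rw [Module.finrank_fin_fun, ← hNdef] at h1
    simp only [Finset.card_univ, Fintype.card_fin, smul_eq_mul] at h2
    omega
  have hW₀ : Module.finrank F W₀ ≤ 2 * b + 1 := by
    refine (LinearMap.finrank_range_le _).trans_eq ?_
    rw [Module.finrank_prod, Module.finrank_self, Module.finrank_pi_fintype, Finset.sum_const, hK]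
    simp only [Finset.card_univ, Fintype.card_fin, smul_eq_mul]
    omega
  have hsq : (b + 2) ^ 2 ≤ Fintype.card F ^ 2 := Nat.pow_le_pow_left hb 2
  have hdim : 2 * b + 1 ≤ Module.finrank F N := by
    have : (b + 2) ^ 2 = b ^ 2 + 4 * b + 4 := by ring
    have := Nat.zero_le (b ^ 2)
    omega
  -- Enlarging inside `N` to the exact dimension avoids proving `traceEval` injective; interpolation
  -- survives enlargement.
  obtain ⟨W, hW₀W, hWN', hW⟩ := Submodule.exists_between_finrank_eq hWN hW₀ hdim
  refine ⟨W, N, hWN', ?_, hW, hN, hdist, fun v S hS => ?_⟩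
  · intro htop
    have hpos : 0 < n := by
      have : 2 ^ 2 ≤ Fintype.card F ^ 2 := Nat.pow_le_pow_left (by omega) 2
      omega
    have h := hdist (Pi.single ⟨0, hpos⟩ 1) (htop ▸ Submodule.mem_top) {⟨0, hpos⟩} (by simp)
      (fun i hi => Pi.single_eq_of_ne (by simpa using hi) _)
    simpa using congrFun h ⟨0, hpos⟩
  · obtain ⟨p, hp⟩ := exists_traceEval_eq hx (m := b) S (by omega) v
    exact ⟨_, hW₀W ⟨p, rfl⟩, hp⟩

theorem mainTheorem6 (q : ℕ) (hq : IsPrimePow q) (hq2 : 2 < q) (n : ℕ) (hn : n = q ^ 2 - 1)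
    (a b : ℕ) (ha : a ≤ q - 1) (hb1 : 1 ≤ b) (hbq : b ≤ q) :
    (q - b ≤ a → b < q →
      ExistsQUENTA q n (2 * (q - b) - 1) (b + 1) (2 * (q - a - 1))) ∧
    (a < q - b →
      ExistsQUENTA q n (2 * a + 1) (b + 1) (2 * b - b / q)) := by
  obtain ⟨F, K, _, _, _, _, _, hF, hK⟩ := FiniteField.exists_finrank_eq_two hq
  -- From here on `b` is one less than in the statement. The old value q is excluded in both
  -- families, so the floor term is zero.
  obtain ⟨b, rfl⟩ : ∃ b', b = b' + 1 := ⟨b - 1, by omega⟩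
  by_cases hb : b + 1 < q
  swap
  · exact ⟨fun _ h => absurd h hb, fun h => by omega⟩
  obtain ⟨W, N, hWN, hNtop, hW, hN, hdist, hrestr⟩ :=
    exists_nested_codes hK (n := n) (b := b) (hF ▸ hn) (hF ▸ hb)
  -- Room in `N` for `W` and the largest `L` needed. In the worst case b = q - 2 this amounts to (q
  -- - 1)(q - 3) ≥ 0, hence q > 2.
  have hdim : 2 * b + 1 + (2 * (q - (b + 1)) - 1) ≤ Module.finrank F N := by
    obtain ⟨r, rfl⟩ : ∃ r, q = b + 2 + r := ⟨q - (b + 2), by omega⟩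
    have h1 : (b + 2 + r) ^ 2 = b ^ 2 + r ^ 2 + 2 * (b * r) + 4 * b + 4 * r + 4 := by ring
    have h2 : 1 ≤ b + r := by omega
    have hb2 : b ≤ b ^ 2 := Nat.le_self_pow two_ne_zero b
    have hr2 : r ≤ r ^ 2 := Nat.le_self_pow two_ne_zero r
    omega
  constructor
  · intro hab _
    obtain ⟨Y, -, hYW, hY⟩ := Submodule.exists_between_finrank_eq (bot_le : ⊥ ≤ W)
      (m := 2 * (q - a - 1)) (by rw [finrank_bot]; exact Nat.zero_le _) (by omega)
    obtain ⟨A, hAW, hYA, hA⟩ := Submodule.exists_disjoint_finrank_eq hYW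
      (m := 2 * b + 1 - 2 * (q - a - 1)) (by omega)
    obtain ⟨L, hLN, hWL, hL⟩ := Submodule.exists_disjoint_finrank_eq hWN
      (m := 2 * (q - (b + 1)) - 1) (by omega)
    have hAY : A ⊔ Y = W := by
      refine Submodule.eq_of_le_of_finrank_eq (sup_le hAW hYW) ?_
      have h := Submodule.finrank_sup_add_finrank_inf_eq A Y
      rw [hYA.symm.eq_bot, finrank_bot] at h
      omega
    refine existsQUENTA_of_submodules hF A Y L hL hY hYA.symm (hAY ▸ hWL) ?_ ?_
    · exact fun v hv => hdist v (sup_le (hAW.trans hWN) hLN hv)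
    · rwa [hAY]
  · intro hab
    rw [Nat.div_eq_of_lt hb, Nat.sub_zero]
    -- `W` has odd dimension 2b + 1, one short of the required number of pairs. A vector outside `N`
    -- supplies the missing dimension and keeps `Y` disjoint from `L ≤ N`.
    obtain ⟨v, -, hv⟩ := SetLike.exists_of_lt (lt_top_iff_ne_top.mpr hNtop)
    obtain ⟨L, hLN, hWL, hL⟩ := Submodule.exists_disjoint_finrank_eq hWN
      (m := 2 * a + 1) (by omega)
    refine existsQUENTA_of_submodules hF ⊥ (W ⊔ Submodule.span F {v}) L hL ?_ disjoint_bot_left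
      ?_ ?_ ?_
    · rw [Submodule.finrank_sup_span_singleton (fun h => hv (hWN h)), hW]
      ring
    · rw [bot_sup_eq, Submodule.disjoint_def]
      intro y hy hyL
      obtain ⟨w, hw, z, hz, rfl⟩ := Submodule.mem_sup.mp hy
      obtain ⟨r, rfl⟩ := Submodule.mem_span_singleton.mp hz
      have hr : r = 0 := by
        by_contra hr
        have h1 : r • v ∈ N := by
          simpa using N.sub_mem (hLN hyL) (hWN hw)
        exact hv ((N.smul_mem_iff hr).mp h1)
      rw [hr, zero_smul, add_zero] at hyL ⊢
      exact Submodule.disjoint_def.mp hWL w hw hyL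
    · rw [bot_sup_eq]
      exact fun u hu => hdist u (hLN hu)
    · intro u S hS
      obtain ⟨w, hw, hwS⟩ := hrestr u S hS
      exact ⟨w, by rw [bot_sup_eq]; exact Submodule.mem_sup_left hw, hwS⟩
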